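/- Let $K : X\times X\to\mathbb{R}$ be a positive definite kernel on a set $X$, let $\mathscr{H}_K$ be its reproducing kernel Hilbert space, and put $K_x = K(\cdot,x)$. Let $\mu$ be a measure on a $\sigma$-algebra of subsets of $X$ such that 1. $K_x\in L^2(\mu)$ for all $x\in X$; 2. the linear span of $\{K_x\}_{x\in X}$ is dense in $L^2(\mu)$; 3. $\|F\|_{L^2(\mu)}\le\|F\|_{\mathscr{H}_K}$ for all $F\in\mathscr{H}_K$, and if $F\in\mathscr{H}_K$ vanishes $\mu$-almost everywhere, then $F=0$. Thus $\mathscr{H}_K$ is densely and contractively included in $L^2(\mu)$; let $J:\mathscr{H}_K\hookrightarrow L^2(\mu)$ be the inclusion map and let $A=(JJ^*)^{-1}$, an operator in $L^2(\mu)$ with domain the range of $JJ^*$. Then: (a) $A$ has exactly one positive self-adjoint square root $A^{1/2}$, each $K_x$ lies in the domain of $A^{1/2}$, and $\Phi:X\to L^2(\mu)$, $\Phi(x)=A^{1/2}K_x$, is a feature map for $K$, i.e. $$K(x,y)=\langle \Phi(x),\Phi(y)\rangle_{L^2(\mu)}\quad\text{for all } x,y\in X.$$ (b) Suppose that $A^{-1}=JJ^*$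 is compact and that $(u_i)_{i\in I}$ is an orthonormal basis of $L^2(\mu)$ with $A^{-1}u_i=\lambda_iu_i$ for all $i\in I$ (for instance $I=\mathbb{N}$ with $\lambda_i$ decreasing to $0$, or $I$ finite). Then $0<\lambda_i\le 1$ for all $i$, and for all $x,y\in X$ $$K(x,y)=\sum_{i\in I}\lambda_i^{-1}\,\langle K_x,u_i\rangle_{L^2(\mu)}\,\langle u_i,K_y\rangle_{L^2(\mu)},$$ where the series converges unconditionally. -/

import Mathlib

open MeasureTheory
open scoped ENNReal InnerProductSpace

noncomputable section

namespace KernelL2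

/-- The kernel section `K_x = K(·, x)`, as an element of the reproducing kernel Hilbert space `H`
of real-valued functions on `X`. -/
def kerSection {X : Type*} (H : Type*) [NormedAddCommGroup H] [InnerProductSpace ℝ H]
    [CompleteSpace H] [RKHS ℝ H X ℝ] (x : X) : H :=
  RKHS.kerFun H x 1

/-- `H` is the reproducing kernel Hilbert space of the scalar kernel `K`: the kernel functions of
`H` are the functions `K(·, x)`. (Such an `H` exists exactly when `K` is positive definite.) -/
def HasKernel {X : Type*} (H : Type*) [NormedAddCommGroup H] [InnerProductSpace ℝ H]
    [CompleteSpace H] [RKHS ℝ H X ℝ] (K : X → X → ℝ) : Prop :=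
  ∀ x y : X, kerSection H x y = K y x

/-- `Φ : X → F` is a feature map for `K`, with feature space the Hilbert space `F`. -/
def IsFeatureMap {X F : Type*} [NormedAddCommGroup F] [InnerProductSpace ℝ F]
    (K : X → X → ℝ) (Φ : X → F) : Prop :=
  ∀ x y : X, K x y = ⟪Φ x, Φ y⟫_ℝ

/-- The reproducing kernel Hilbert space `H` of functions on `X` is densely and contractively
included in `L²(μ)`. -/
structure DenseContractiveInclusion {X : Type*} [MeasurableSpace X] (μ : Measure X)
    (H : Type*) [NormedAddCommGroup H] [InnerProductSpace ℝ H] [CompleteSpace H]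
    [RKHS ℝ H X ℝ] : Prop where
  /-- every `K_x` is square integrable -/
  memLp_kerSection : ∀ x : X, MemLp (kerSection H x : X → ℝ) 2 μ
  /-- the linear span of the `K_x` is dense in `L²(μ)` -/
  dense_span : Dense (Submodule.span ℝ
    (Set.range fun x : X => (memLp_kerSection x).toLp (kerSection H x : X → ℝ)) :
      Set (Lp ℝ 2 μ))
  /-- `‖f‖_{L²(μ)} ≤ ‖f‖_H` -/
  eLpNorm_le : ∀ f : H, eLpNorm (f : X → ℝ) 2 μ ≤ ENNReal.ofReal ‖f‖
  /-- the map `H → L²(μ)` is an inclusion, i.e. it is injective -/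
  eq_zero_of_ae : ∀ f : H, (f : X → ℝ) =ᵐ[μ] 0 → f = 0

namespace DenseContractiveInclusion

variable {X : Type*} [MeasurableSpace X] {μ : Measure X}
    {H : Type*} [NormedAddCommGroup H] [InnerProductSpace ℝ H] [CompleteSpace H]
    [RKHS ℝ H X ℝ]

theorem aestronglyMeasurable (h : DenseContractiveInclusion μ H) (f : H) :
    AEStronglyMeasurable (f : X → ℝ) μ := by
  have hspan : ∀ g ∈ Submodule.span ℝ {RKHS.kerFun H x v | (x : X) (v : ℝ)},
      AEStronglyMeasurable (g : X → ℝ) μ := by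
    intro g hg
    induction hg using Submodule.span_induction with
    | mem g hg =>
      obtain ⟨x, v, rfl⟩ := hg
      have hv : RKHS.kerFun H x v = v • kerSection H x := by
        simp [kerSection, ← map_smul]
      rw [hv, RKHS.coe_smul]
      exact (h.memLp_kerSection x).1.const_smul v
    | zero => rw [RKHS.coe_zero]; exact aestronglyMeasurable_zero
    | add g₁ g₂ _ _ h₁ h₂ => rw [RKHS.coe_add]; exact h₁.add h₂
    | smul c g _ hg => rw [RKHS.coe_smul]; exact hg.const_smul c
  have hf : f ∈ closure
      (Submodule.span ℝ {RKHS.kerFun H x v | (x : X) (v : ℝ)} : Set H) := by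
    rw [← Submodule.topologicalClosure_coe, RKHS.kerFun_dense H]
    trivial
  obtain ⟨u, hu, hlim⟩ := mem_closure_iff_seq_limit.1 hf
  refine aestronglyMeasurable_of_tendsto_ae Filter.atTop (fun n => hspan _ (hu n)) ?_
  exact Filter.Eventually.of_forall fun x =>
    ((RKHS.continuous_eval (H := H) x).tendsto f).comp hlim

theorem memLp (h : DenseContractiveInclusion μ H) (f : H) : MemLp (f : X → ℝ) 2 μ :=
  ⟨h.aestronglyMeasurable f, (h.eLpNorm_le f).trans_lt ENNReal.ofReal_lt_top⟩

/-- The inclusion map `J : H → L²(μ)`. -/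
def incl (h : DenseContractiveInclusion μ H) : H →L[ℝ] Lp ℝ 2 μ :=
  LinearMap.mkContinuous
    { toFun := fun f => (h.memLp f).toLp (f : X → ℝ)
      map_add' := fun f g => by
        rw [← MemLp.toLp_add]
        exact MemLp.toLp_congr _ _ (by rw [RKHS.coe_add])
      map_smul' := fun c f => by
        rw [RingHom.id_apply, ← MemLp.toLp_const_smul]
        exact MemLp.toLp_congr _ _ (by rw [RKHS.coe_smul]) }
    1 (fun f => by
      rw [one_mul, LinearMap.coe_mk, AddHom.coe_mk, Lp.norm_toLp]
      exact ENNReal.toReal_le_of_le_ofReal (norm_nonneg f) (h.eLpNorm_le f))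

/-- The bounded operator `A⁻¹ = J J*` on `L²(μ)`. -/
def opAInv (h : DenseContractiveInclusion μ H) : Lp ℝ 2 μ →L[ℝ] Lp ℝ 2 μ :=
  h.incl ∘L h.incl.adjoint

/-- The (in general unbounded) operator `A = (J J*)⁻¹` in `L²(μ)`, with domain the range of
`J J*`. -/
def opA (h : DenseContractiveInclusion μ H) : Lp ℝ 2 μ →ₗ.[ℝ] Lp ℝ 2 μ :=
  ((h.opAInv : Lp ℝ 2 μ →ₗ[ℝ] Lp ℝ 2 μ).toPMap ⊤).inverse

end DenseContractiveInclusion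

/-- `S` is a positive self-adjoint square root `A^{1/2}` of the (unbounded) operator `A`:
`S` is self-adjoint, `⟨S v, v⟩ ≥ 0` on its domain, and `S ∘ S = A`, where `S ∘ S` has its natural
domain `{v ∈ dom S | S v ∈ dom S}`. -/
structure IsPositiveSqrt {E : Type*} [NormedAddCommGroup E] [InnerProductSpace ℝ E]
    [CompleteSpace E] (S A : E →ₗ.[ℝ] E) : Prop where
  isSelfAdjoint : IsSelfAdjoint S
  nonneg : ∀ v : S.domain, 0 ≤ ⟪S v, (v : E)⟫_ℝ
  sq_eq : ∀ v w : E, (v, w) ∈ A.graph ↔ ∃ z : E, (v, z) ∈ S.graph ∧ (z, w) ∈ S.graph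

end KernelL2

end

/-!
Write `E = L²(μ)`, `J : H → E` for the inclusion and `T = J J*`, so that `A = T⁻¹`. The hypotheses
say that `J` is an injective contraction with dense range; hence `J*` has the same properties,
and `T` is injective with `‖1 - T‖ ≤ 1`.

Mathlib's continuous functional calculus needs complex scalars, so the bounded positive square root
`B` of `T` is built by hand: the iteration `y ↦ (r + y²) / 2` with `r = 1 - T` converges in norm to
some `y` with `(1 - y)² = T`, because its increments are dominated by those of the same iteration
for the scalar `r = 1` (`norm_sqrtIter_succ_sub_le`). As a limit of polynomials in `T`, the operator
`B = 1 - y` commutes with everything that commutes with `T`.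

The unbounded operator `B⁻¹` is a positive self-adjoint square root of `A`. Conversely, any such
square root `S` maps its domain bijectively onto `E`, and its inverse is symmetric and everywhere
defined, hence a bounded positive operator `C` by the Hellinger–Toeplitz theorem
(`KernelL2.IsPositiveSqrt.exists_isPositive`). Since `C² = T`, it commutes with `B`, and commuting
positive operators with equal squares coincide; thus `S = B⁻¹`.

Since `‖B w‖ = ‖J* w‖`, the map `J* w ↦ B w` extends to an isometry `V : H → E` with `B V = J`
(`exists_comp_eq_of_mul_self_eq`). So `J f` lies in the range of `B`, which is the domain of
`A^{1/2}`, with `A^{1/2} J f = V f`, and `⟪V K_x, V K_y⟫ = ⟪K_x, K_y⟫ = K x y` by the reproducing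
property. If `T u_i = λ_i u_i`, then `B u_i = √λ_i u_i`, so `⟪J f, u_i⟫ = √λ_i ⟪V f, u_i⟫`, and the
expansion of the kernel is Parseval's identity for `⟪V K_x, V K_y⟫`.
-/

noncomputable section

open Filter Topology

/-! ### Square roots of bounded positive operators -/

/-- The iteration `t ↦ (r + t ^ 2) / 2`, started at `0`. Its fixed points `y` satisfy
`(1 - y) ^ 2 = 1 - r`. -/
def sqrtIter {A : Type*} [Ring A] [Algebra ℝ A] (r : A) : ℕ → A
  | 0 => 0
  | n + 1 => (2⁻¹ : ℝ) • (r + sqrtIter r n * sqrtIter r n)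

theorem commute_sqrtIter {A : Type*} [Ring A] [Algebra ℝ A] {r c : A} (h : Commute r c) (n : ℕ) :
    Commute (sqrtIter r n) c := by
  induction n with
  | zero => exact Commute.zero_left c
  | succ n ih => exact (h.add_left (ih.mul_left ih)).smul_left _

theorem isSelfAdjoint_sqrtIter {A : Type*} [Ring A] [Algebra ℝ A] [StarRing A] [StarModule ℝ A]
    {r : A} (h : IsSelfAdjoint r) (n : ℕ) : IsSelfAdjoint (sqrtIter r n) := by
  induction n with
  | zero => exact IsSelfAdjoint.zero A
  | succ n ih =>
    refine IsSelfAdjoint.smul (IsSelfAdjoint.all _) (h.add ?_)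
    rw [isSelfAdjoint_iff, star_mul, ih.star_eq]

theorem sqrtIter_one_mem (n : ℕ) : 0 ≤ sqrtIter (1 : ℝ) n ∧ sqrtIter (1 : ℝ) n ≤ 1 := by
  induction n with
  | zero => simp [sqrtIter]
  | succ n ih =>
    simp only [sqrtIter, smul_eq_mul]
    constructor <;> nlinarith [ih.1, ih.2]

theorem monotone_sqrtIter_one : Monotone (sqrtIter (1 : ℝ)) := by
  refine monotone_nat_of_le_succ fun n => ?_
  simp only [sqrtIter, smul_eq_mul]
  nlinarith [sq_nonneg (sqrtIter (1 : ℝ) n - 1)]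

theorem norm_sqrtIter_le {A : Type*} [NormedRing A] [NormedAlgebra ℝ A] {r : A} (hr : ‖r‖ ≤ 1)
    (n : ℕ) : ‖sqrtIter r n‖ ≤ sqrtIter (1 : ℝ) n := by
  induction n with
  | zero => simp [sqrtIter]
  | succ n ih =>
    simp only [sqrtIter, norm_smul, smul_eq_mul, norm_inv, Real.norm_ofNat]
    gcongr
    refine (norm_add_le _ _).trans (add_le_add hr ((norm_mul_le _ _).trans ?_))
    exact mul_le_mul ih ih (norm_nonneg _) (sqrtIter_one_mem n).1

/-- The iterates are polynomials in `r` with nonnegative coefficients, so the increments at `r`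
are dominated by those at the scalar `1`. -/
theorem norm_sqrtIter_succ_sub_le {A : Type*} [NormedRing A] [NormedAlgebra ℝ A] {r : A}
    (hr : ‖r‖ ≤ 1) (n : ℕ) :
    ‖sqrtIter r (n + 1) - sqrtIter r n‖ ≤ sqrtIter (1 : ℝ) (n + 1) - sqrtIter (1 : ℝ) n := by
  induction n with
  | zero =>
    simp only [sqrtIter, norm_smul, smul_eq_mul, norm_inv, Real.norm_ofNat, mul_zero, add_zero,
      sub_zero]
    linarith
  | succ n ih =>
    have hfac : sqrtIter r (n + 1 + 1) - sqrtIter r (n + 1) = (2⁻¹ : ℝ) •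
        ((sqrtIter r (n + 1) + sqrtIter r n) * (sqrtIter r (n + 1) - sqrtIter r n)) := by
      have hc : Commute (sqrtIter r (n + 1)) (sqrtIter r n) :=
        commute_sqrtIter (commute_sqrtIter (Commute.refl r) n).symm _
      rw [← hc.mul_self_sub_mul_self_eq, ← add_sub_add_left_eq_sub (sqrtIter r (n + 1) * _) _ r,
        smul_sub]
      rfl
    have h1 : sqrtIter (1 : ℝ) (n + 1 + 1) =
        2⁻¹ * (1 + sqrtIter (1 : ℝ) (n + 1) * sqrtIter (1 : ℝ) (n + 1)) := rfl
    have h2 : sqrtIter (1 : ℝ) (n + 1) =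
        2⁻¹ * (1 + sqrtIter (1 : ℝ) n * sqrtIter (1 : ℝ) n) := rfl
    calc ‖sqrtIter r (n + 1 + 1) - sqrtIter r (n + 1)‖
        ≤ 2⁻¹ * ((sqrtIter (1 : ℝ) (n + 1) + sqrtIter (1 : ℝ) n) *
            (sqrtIter (1 : ℝ) (n + 1) - sqrtIter (1 : ℝ) n)) := by
          rw [hfac, norm_smul, norm_inv, Real.norm_ofNat]
          gcongr
          refine (norm_mul_le _ _).trans (mul_le_mul ?_ ih (norm_nonneg _) ?_)
          · exact (norm_add_le _ _).trans
              (add_le_add (norm_sqrtIter_le hr _) (norm_sqrtIter_le hr _))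
          · exact add_nonneg (sqrtIter_one_mem _).1 (sqrtIter_one_mem _).1
      _ = sqrtIter (1 : ℝ) (n + 1 + 1) - sqrtIter (1 : ℝ) (n + 1) := by
          linear_combination h2 - h1

theorem exists_tendsto_sqrtIter {A : Type*} [NormedRing A] [NormedAlgebra ℝ A] [CompleteSpace A]
    {r : A} (hr : ‖r‖ ≤ 1) : ∃ y : A, Tendsto (sqrtIter r) atTop (𝓝 y) := by
  refine cauchySeq_tendsto_of_complete (cauchySeq_of_dist_le_of_summable _ (fun n => ?_)
    (summable_of_sum_range_le (c := 1) (f := fun n => sqrtIter (1 : ℝ) (n + 1) - sqrtIter 1 n)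
      (fun n => sub_nonneg.2 (monotone_sqrtIter_one n.le_succ)) fun n => ?_))
  · rw [dist_comm, dist_eq_norm]
    exact norm_sqrtIter_succ_sub_le hr n
  · rw [Finset.sum_range_sub]
    simpa [sqrtIter] using (sqrtIter_one_mem n).2

/-- In a Banach *-algebra, an element at distance at most `1` from `1` has a square root at distance
at most `1` from `1`; it is a limit of polynomials in the given element. -/
theorem exists_mul_self_eq_of_norm_one_sub_le {A : Type*} [NormedRing A] [NormedAlgebra ℝ A]
    [CompleteSpace A] [StarRing A] [StarModule ℝ A] [ContinuousStar A]
    {a : A} (ha : ‖1 - a‖ ≤ 1) :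
    ∃ b : A, b * b = a ∧ ‖1 - b‖ ≤ 1 ∧ (∀ c, Commute a c → Commute b c) ∧
      (IsSelfAdjoint a → IsSelfAdjoint b) := by
  obtain ⟨y, hy⟩ := exists_tendsto_sqrtIter ha
  have hfix : y = (2⁻¹ : ℝ) • ((1 - a) + y * y) :=
    tendsto_nhds_unique ((tendsto_add_atTop_iff_nat 1).2 hy)
      (((hy.mul hy).const_add (1 - a)).const_smul (2⁻¹ : ℝ))
  refine ⟨1 - y, ?_, ?_, fun c hc => ?_, fun hsa => ?_⟩
  · have h2 : (2 : ℝ) • y = (1 - a) + y * y := by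
      nth_rw 1 [hfix]
      rw [smul_smul]; norm_num
    rw [two_smul] at h2
    have h3 : (1 - y) * (1 - y) = 1 + y * y - (y + y) := by noncomm_ring
    rw [h3, h2]; abel
  · rw [sub_sub_cancel]
    exact le_of_tendsto hy.norm (Eventually.of_forall fun n =>
      (norm_sqrtIter_le ha n).trans (sqrtIter_one_mem n).2)
  · refine (Commute.one_left c).sub_left ?_
    have hn (n : ℕ) := (commute_sqrtIter ((Commute.one_left c).sub_left hc) n).eq
    refine tendsto_nhds_unique (hy.mul_const c) ?_
    simp only [hn]
    exact hy.const_mul c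
  · refine (IsSelfAdjoint.one A).sub (tendsto_nhds_unique hy.star ?_)
    simp only [(isSelfAdjoint_sqrtIter ((IsSelfAdjoint.one A).sub hsa) _).star_eq]
    exact hy

section Operators

variable {E : Type*} [NormedAddCommGroup E] [InnerProductSpace ℝ E]

theorem ContinuousLinearMap.IsPositive.eq_zero_of_inner_eq_zero {B : E →L[ℝ] E}
    (hB : B.IsPositive) {y : E} (hy : ⟪B y, y⟫_ℝ = 0) : B y = 0 := by
  -- `t ↦ ⟪B (y + t • B y), y + t • B y⟫` is nonnegative, vanishes at `0` and has slope `2 ‖B y‖ ^ 2`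
  by_contra hne
  have hpos : 0 < ‖B y‖ ^ 2 := by positivity
  set c := ⟪B (B y), B y⟫_ℝ with hc
  have hc0 : 0 ≤ c := hB.inner_nonneg_left _
  have key (t : ℝ) : 0 ≤ 2 * t * ‖B y‖ ^ 2 + t ^ 2 * c := by
    have h := hB.inner_nonneg_left (y + t • B y)
    have hs : ⟪B (B y), y⟫_ℝ = ‖B y‖ ^ 2 := by
      rw [hB.inner_left_eq_inner_right, real_inner_self_eq_norm_sq]
    simp only [map_add, map_smul, inner_add_left, inner_add_right, real_inner_smul_left,
      real_inner_smul_right, hy, hs, real_inner_self_eq_norm_sq, ← hc] at h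
    linarith
  have h := key (-(‖B y‖ ^ 2 / (c + 1)))
  have hd : ‖B y‖ ^ 2 / (c + 1) * (c + 1) = ‖B y‖ ^ 2 := by field_simp
  have hd0 : 0 < ‖B y‖ ^ 2 / (c + 1) := by positivity
  nlinarith

/-- A positive operator shares the eigenvectors of its square. -/
theorem ContinuousLinearMap.IsPositive.apply_eq_sqrt_smul {B : E →L[ℝ] E} (hB : B.IsPositive)
    {u : E} {c : ℝ} (hc : 0 < c) (hu : (B * B) u = c • u) : B u = √c • u := by
  -- `z = B u - √c • u` satisfies `B z = -√c • z`, which forces `z = 0` by positivity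
  set z := B u - √c • u with hz
  have hBz : B z = -(√c • z) := by
    have h : B (B u) = (√c * √c) • u := by rwa [Real.mul_self_sqrt hc.le]
    rw [hz, map_sub, map_smul, h, smul_sub, smul_smul]
    abel
  have h := hB.inner_nonneg_left z
  rw [hBz, inner_neg_left, real_inner_smul_left, real_inner_self_eq_norm_sq] at h
  have hc' := Real.sqrt_pos.2 hc
  have hz0 : ‖z‖ ^ 2 = 0 := le_antisymm (by nlinarith) (sq_nonneg _)
  exact sub_eq_zero.1 (by simpa using hz0)

variable [CompleteSpace E]

theorem ContinuousLinearMap.isPositive_of_norm_one_sub_le {B : E →L[ℝ] E} (hB : IsSelfAdjoint B)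
    (h1 : ‖1 - B‖ ≤ 1) : B.IsPositive := by
  refine B.isPositive_iff'.2 ⟨hB, fun x => ?_⟩
  have h : ⟪(1 - B) x, x⟫_ℝ ≤ ‖x‖ * ‖x‖ := by
    refine (real_inner_le_norm _ _).trans (mul_le_mul_of_nonneg_right ?_ (norm_nonneg x))
    simpa using (1 - B).le_of_opNorm_le h1 x
  rw [sub_apply, one_apply_eq_self, inner_sub_left, real_inner_self_eq_norm_mul_norm] at h
  linarith

/-- Two commuting positive operators with the same square are equal. -/
theorem ContinuousLinearMap.IsPositive.eq_of_mul_self_eq {B C : E →L[ℝ] E} (hB : B.IsPositive)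
    (hC : C.IsPositive) (hcomm : Commute B C) (h : B * B = C * C) : B = C := by
  have hD : IsSelfAdjoint (B - C) := hB.isSelfAdjoint.sub hC.isSelfAdjoint
  have hprod : (B + C) * (B - C) = 0 := by
    rw [← hcomm.mul_self_sub_mul_self_eq, h, sub_self]
  ext x
  rw [← sub_eq_zero, ← sub_apply]
  set y := (B - C) x with hy
  have hsum : ⟪B y, y⟫_ℝ + ⟪C y, y⟫_ℝ = 0 := by
    rw [← inner_add_left, ← add_apply, hy, ← mul_apply_eq_comp, hprod]
    simp
  have hB0 := hB.inner_nonneg_left y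
  have hC0 := hC.inner_nonneg_left y
  have hBy : B y = 0 := hB.eq_zero_of_inner_eq_zero (by linarith)
  have hCy : C y = 0 := hC.eq_zero_of_inner_eq_zero (by linarith)
  rw [← inner_self_eq_zero (𝕜 := ℝ)]
  exact ((isSelfAdjoint_iff_isSymmetric.1 hD) x y).trans (by simp [hBy, hCy])

/-- If `‖J‖ ≤ 1` then `J J*` lies within distance `1` of the identity. -/
theorem norm_one_sub_comp_adjoint_le {F : Type*} [NormedAddCommGroup F] [InnerProductSpace ℝ F]
    [CompleteSpace F] {J : F →L[ℝ] E} (hJ : ‖J‖ ≤ 1) : ‖1 - J ∘L J.adjoint‖ ≤ 1 := by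
  refine ContinuousLinearMap.opNorm_le_bound _ zero_le_one fun x => ?_
  rw [one_mul]
  refine le_of_sq_le_sq ?_ (norm_nonneg x)
  have h1 : ‖J (J.adjoint x)‖ ≤ ‖J.adjoint x‖ := by simpa using J.le_of_opNorm_le hJ (J.adjoint x)
  have h2 : ⟪x, J (J.adjoint x)⟫_ℝ = ‖J.adjoint x‖ ^ 2 := by
    rw [← J.adjoint_inner_left, real_inner_self_eq_norm_sq]
  have h3 : (1 - J ∘L J.adjoint) x = x - J (J.adjoint x) := by simp
  rw [h3, norm_sub_sq_real, h2]
  nlinarith [norm_nonneg (J (J.adjoint x)), norm_nonneg (J.adjoint x)]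

end Operators

/-! ### Inverses and square roots of unbounded operators -/

section Unbounded

variable {E : Type*} [NormedAddCommGroup E] [InnerProductSpace ℝ E]

theorem LinearPMap.mem_graph_inverse_toPMap_top_iff {B : E →L[ℝ] E} (hB : Function.Injective B)
    {v w : E} : (v, w) ∈ ((B : E →ₗ[ℝ] E).toPMap ⊤).inverse.graph ↔ B w = v := by
  have hker : LinearMap.ker ((B : E →ₗ[ℝ] E).toPMap ⊤).toFun = ⊥ := by
    refine LinearMap.ker_eq_bot'.2 fun m hm => Subtype.ext (hB ?_)
    exact Eq.trans (show B m = 0 from hm) B.map_zero.symm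
  rw [LinearPMap.inverse_graph hker]
  constructor
  · rintro ⟨⟨a, b⟩, hab, heq⟩
    obtain ⟨rfl, rfl⟩ : b = v ∧ a = w := by simpa using heq
    obtain ⟨y, rfl, hy⟩ := (LinearPMap.mem_graph_iff _).1 hab
    exact hy
  · intro h
    exact ⟨(w, v), (LinearPMap.mem_graph_iff _).2 ⟨⟨w, trivial⟩, rfl, h⟩, rfl⟩

variable [CompleteSpace E]

theorem IsSelfAdjoint.denseRange_of_injective {B : E →L[ℝ] E} (hB : IsSelfAdjoint B)
    (hinj : Function.Injective B) : DenseRange B := by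
  have h : B.rangeᗮ = ⊥ := by
    rw [ContinuousLinearMap.orthogonal_range, hB.adjoint_eq]
    exact LinearMap.ker_eq_bot.2 hinj
  have h' := (Submodule.topologicalClosure_eq_top_iff (K := B.range)).2 h
  exact Submodule.dense_iff_topologicalClosure_eq_top.2 h'

theorem LinearPMap.isSelfAdjoint_of_mem_graph_iff {B : E →L[ℝ] E} (hB : IsSelfAdjoint B)
    (hinj : Function.Injective B) {S : E →ₗ.[ℝ] E}
    (hS : ∀ v w, (v, w) ∈ S.graph ↔ B w = v) : IsSelfAdjoint S := by
  have hsymm (x y : E) : ⟪B x, y⟫_ℝ = ⟪x, B y⟫_ℝ :=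
    ContinuousLinearMap.isSelfAdjoint_iff_isSymmetric.1 hB x y
  have hdense : Dense (S.domain : Set E) := by
    refine (hB.denseRange_of_injective hinj).mono ?_
    rintro _ ⟨w, rfl⟩
    exact LinearPMap.mem_domain_of_mem_graph ((hS (B w) w).2 rfl)
  rw [LinearPMap.isSelfAdjoint_def]
  refine LinearPMap.eq_of_eq_graph ?_
  rw [LinearPMap.adjoint_graph_eq_graph_adjoint hdense]
  ext ⟨v, w⟩
  rw [Submodule.mem_adjoint_iff, hS]
  constructor
  · intro h
    refine ext_inner_left ℝ fun z => ?_
    have := h (B z) z ((hS _ _).2 rfl)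
    rw [← hsymm]
    exact (sub_eq_zero.1 this).symm
  · rintro rfl a b hab
    rw [← (hS a b).1 hab, hsymm, sub_self]

theorem IsSelfAdjoint.inner_eq_of_mem_graph {S : E →ₗ.[ℝ] E} (hS : IsSelfAdjoint S)
    {a b v w : E} (h₁ : (a, b) ∈ S.graph) (h₂ : (v, w) ∈ S.graph) : ⟪b, v⟫_ℝ = ⟪a, w⟫_ℝ := by
  have h : (v, w) ∈ S.graph.adjoint := by
    rw [← LinearPMap.adjoint_graph_eq_graph_adjoint hS.dense_domain,
      LinearPMap.isSelfAdjoint_def.1 hS]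
    exact h₂
  exact sub_eq_zero.1 ((Submodule.mem_adjoint_iff _ _).1 h a b h₁)

namespace KernelL2

variable {T B : E →L[ℝ] E} {A S : E →ₗ.[ℝ] E}

theorem isPositiveSqrt_of_mem_graph_iff (hA : ∀ v w, (v, w) ∈ A.graph ↔ T w = v)
    (hB : B.IsPositive) (hinj : Function.Injective B) (hBT : B * B = T)
    (hS : ∀ v w, (v, w) ∈ S.graph ↔ B w = v) : IsPositiveSqrt S A where
  isSelfAdjoint := LinearPMap.isSelfAdjoint_of_mem_graph_iff hB.isSelfAdjoint hinj hS
  nonneg v := by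
    have h : B (S v) = v := (hS _ _).1 (S.mem_graph v)
    rw [← h]
    exact hB.inner_nonneg_right _
  sq_eq v w := by
    simp only [hA, hS, exists_eq_right', ← hBT]
    exact Iff.rfl

/-- If `A` is the inverse of an everywhere defined operator, each positive self-adjoint square root
of `A` is a bijection onto the whole space; its inverse is symmetric and everywhere defined, hence
bounded. -/
theorem IsPositiveSqrt.exists_isPositive (hS : IsPositiveSqrt S A)
    (hA : ∀ v w, (v, w) ∈ A.graph ↔ T w = v) :
    ∃ C : E →L[ℝ] E, C.IsPositive ∧ C * C = T ∧ ∀ v w, (v, w) ∈ S.graph ↔ C w = v := by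
  have hker (z : E) (hz : (z, 0) ∈ S.graph) : z = 0 := by
    have := (hA z 0).1 ((hS.sq_eq z 0).2 ⟨0, hz, S.graph.zero_mem⟩)
    rw [← this, map_zero]
  have huniq {v v' w : E} (h : (v, w) ∈ S.graph) (h' : (v', w) ∈ S.graph) : v = v' :=
    sub_eq_zero.1 (hker _ (by simpa using S.graph.sub_mem h h'))
  have hsurj (w : E) : ∃ v, (v, w) ∈ S.graph := by
    obtain ⟨z, -, hz⟩ := (hS.sq_eq (T w) w).1 ((hA _ _).2 rfl)
    exact ⟨z, hz⟩
  choose c hc using hsurj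
  let L : E →ₗ[ℝ] E :=
    { toFun := c
      map_add' := fun x y => huniq (hc _) (by simpa using S.graph.add_mem (hc x) (hc y))
      map_smul' := fun t x => huniq (hc _) (by simpa using S.graph.smul_mem t (hc x)) }
  have hL : L.IsSymmetric := fun x y => hS.isSelfAdjoint.inner_eq_of_mem_graph (hc x) (hc y) |>.symm
  refine ⟨⟨L, hL.continuous⟩, ?_, ?_, fun v w => ⟨fun h => huniq (hc w) h, ?_⟩⟩
  · refine (ContinuousLinearMap.isPositive_iff _).2 ⟨hL, fun w => ?_⟩
    obtain ⟨y, hy, hy'⟩ := (LinearPMap.mem_graph_iff _).1 (hc w)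
    have := hS.nonneg y
    simp only at hy hy'
    rw [hy, hy', real_inner_comm] at this
    exact this
  · ext w
    exact ((hA _ _).1 ((hS.sq_eq _ w).2 ⟨c w, hc (c w), hc w⟩)).symm
  · rintro rfl
    exact hc w

theorem IsPositiveSqrt.mem_graph_iff (hS : IsPositiveSqrt S A)
    (hA : ∀ v w, (v, w) ∈ A.graph ↔ T w = v) (hB : B.IsPositive) (hBT : B * B = T)
    (hcomm : ∀ C, Commute T C → Commute B C) (v w : E) : (v, w) ∈ S.graph ↔ B w = v := by
  obtain ⟨C, hC, hCT, hgraph⟩ := hS.exists_isPositive hA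
  -- `C` commutes with `T = C * C`, hence with `B`
  have hBC : Commute B C :=
    hcomm C (hCT ▸ (Commute.refl C).mul_left (Commute.refl C))
  rw [hgraph, hB.eq_of_mul_self_eq hC hBC (hBT.trans hCT.symm)]

end KernelL2

/-- Polar decomposition: if `B` is self-adjoint with `B * B = J J*` and `J*` has dense range, then
`J = B V` with an isometry `V`, the continuous extension of `J* w ↦ B w`. -/
theorem exists_comp_eq_of_mul_self_eq {F : Type*} [NormedAddCommGroup F] [InnerProductSpace ℝ F]
    [CompleteSpace F] {J : F →L[ℝ] E} (hJ : DenseRange J.adjoint) {B : E →L[ℝ] E}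
    (hB : IsSelfAdjoint B) (hBJ : B * B = J ∘L J.adjoint) :
    ∃ V : F →L[ℝ] E, (∀ f, B (V f) = J f) ∧ ∀ f g, ⟪V f, V g⟫_ℝ = ⟪f, g⟫_ℝ := by
  have hBB (w : E) : B (B w) = J (J.adjoint w) := DFunLike.congr_fun hBJ w
  have hinner (w z : E) : ⟪B w, B z⟫_ℝ = ⟪J.adjoint w, J.adjoint z⟫_ℝ := by
    rw [J.adjoint_inner_left, ← hBB]
    exact ContinuousLinearMap.isSelfAdjoint_iff_isSymmetric.1 hB w (B z)
  have hnorm (w : E) : ‖B w‖ = ‖J.adjoint w‖ := by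
    rw [norm_eq_sqrt_real_inner, norm_eq_sqrt_real_inner, hinner]
  let V : F →L[ℝ] E := (B : E →ₗ[ℝ] E).extendOfNorm (J.adjoint : E →ₗ[ℝ] F)
  have hV (w : E) : V (J.adjoint w) = B w :=
    LinearMap.extendOfNorm_eq hJ ⟨1, fun w => by simpa using (hnorm w).le⟩ w
  refine ⟨V, fun f => ?_, fun f g => ?_⟩
  · refine hJ.induction_on f (isClosed_eq (by fun_prop) (by fun_prop)) fun w => ?_
    rw [hV, hBB]
  · refine hJ.induction_on₂ (isClosed_eq (by fun_prop) (by fun_prop)) (fun w z => ?_) f g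
    rw [hV, hV, hinner]

end Unbounded

/-! ### The inclusion of the reproducing kernel Hilbert space -/

namespace KernelL2

variable {X : Type*} {H : Type*} [NormedAddCommGroup H] [InnerProductSpace ℝ H] [CompleteSpace H]
  [RKHS ℝ H X ℝ]

theorem HasKernel.inner_kerSection {K : X → X → ℝ} (hK : HasKernel H K) (x y : X) :
    ⟪kerSection H x, kerSection H y⟫_ℝ = K x y := by
  rw [← hK y x, kerSection, RKHS.kerFun_inner]
  simp

namespace DenseContractiveInclusion

variable [MeasurableSpace X] {μ : Measure X} (h : DenseContractiveInclusion μ H)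

theorem incl_injective : Function.Injective h.incl := by
  refine (injective_iff_map_eq_zero _).2 fun f hf => h.eq_zero_of_ae f ?_
  exact (MemLp.toLp_eq_toLp_iff (h.memLp f) MemLp.zero).1 (hf.trans (MemLp.toLp_zero _).symm)

theorem denseRange_incl : DenseRange h.incl := by
  refine h.dense_span.mono ?_
  have : Submodule.span ℝ (Set.range fun x : X =>
      (h.memLp_kerSection x).toLp (kerSection H x : X → ℝ)) ≤ h.incl.range := by
    rw [Submodule.span_le]
    rintro _ ⟨x, rfl⟩
    exact ⟨kerSection H x, rfl⟩
  exact this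

theorem norm_incl_le : ‖h.incl‖ ≤ 1 := LinearMap.mkContinuous_norm_le _ zero_le_one _

theorem adjoint_incl_injective : Function.Injective h.incl.adjoint := by
  refine (injective_iff_map_eq_zero _).2 fun v hv => ?_
  refine h.denseRange_incl.eq_zero_of_inner_left ℝ ?_
  intro f
  rw [← h.incl.adjoint_inner_left, hv, inner_zero_left]

theorem denseRange_adjoint_incl : DenseRange h.incl.adjoint := by
  have h1 : h.incl.adjoint.rangeᗮ = ⊥ := by
    rw [ContinuousLinearMap.orthogonal_range, ContinuousLinearMap.adjoint_adjoint]
    exact LinearMap.ker_eq_bot.2 h.incl_injective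
  exact Submodule.dense_iff_topologicalClosure_eq_top.2
    ((Submodule.topologicalClosure_eq_top_iff (K := h.incl.adjoint.range)).2 h1)

theorem opAInv_injective : Function.Injective h.opAInv :=
  h.incl_injective.comp h.adjoint_incl_injective

theorem mem_graph_opA_iff (v w : Lp ℝ 2 μ) : (v, w) ∈ h.opA.graph ↔ h.opAInv w = v :=
  LinearPMap.mem_graph_inverse_toPMap_top_iff h.opAInv_injective

/-- The bounded positive square root of `J J*`, whose inverse is `A^{1/2}`. -/
theorem exists_sqrt_opAInv : ∃ B : Lp ℝ 2 μ →L[ℝ] Lp ℝ 2 μ, B.IsPositive ∧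
    Function.Injective B ∧ B * B = h.opAInv ∧ ∀ C, Commute h.opAInv C → Commute B C := by
  obtain ⟨B, hBB, hB1, hcomm, hsa⟩ :=
    exists_mul_self_eq_of_norm_one_sub_le (norm_one_sub_comp_adjoint_le h.norm_incl_le)
  refine ⟨B, ContinuousLinearMap.isPositive_of_norm_one_sub_le (hsa
    (ContinuousLinearMap.isPositive_self_comp_adjoint h.incl).isSelfAdjoint) hB1, ?_, hBB, hcomm⟩
  refine Function.Injective.of_comp (f := B) ?_
  have : (B ∘ B : Lp ℝ 2 μ → Lp ℝ 2 μ) = h.opAInv := congrArg DFunLike.coe hBB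
  rw [this]
  exact h.opAInv_injective

theorem eigenvalue_opAInv_pos_and_le_one {u : Lp ℝ 2 μ} (hu : ‖u‖ = 1) {c : ℝ}
    (huc : h.opAInv u = c • u) : 0 < c ∧ c ≤ 1 := by
  have hc : c = ‖h.incl.adjoint u‖ ^ 2 := by
    have h1 : ⟪u, h.opAInv u⟫_ℝ = ‖h.incl.adjoint u‖ ^ 2 := by
      rw [← real_inner_self_eq_norm_sq, h.incl.adjoint_inner_left]
      rfl
    rw [huc, real_inner_smul_right, real_inner_self_eq_norm_sq, hu] at h1
    linarith
  have hne : h.incl.adjoint u ≠ 0 := fun h0 => by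
    have hu0 := h.adjoint_incl_injective (h0.trans (map_zero _).symm)
    simp [hu0] at hu
  have hle : ‖h.incl.adjoint u‖ ≤ 1 := by
    have hn : ‖h.incl.adjoint‖ ≤ 1 := by
      rw [LinearIsometryEquiv.norm_map]
      exact h.norm_incl_le
    simpa [hu] using h.incl.adjoint.le_of_opNorm_le hn u
  rw [hc]
  exact ⟨by positivity, pow_le_one₀ (norm_nonneg _) hle⟩

end DenseContractiveInclusion

end KernelL2

end

theorem mainTheorem12 {X : Type*} [MeasurableSpace X] (μ : Measure X) (K : X → X → ℝ)
    (H : Type*) [NormedAddCommGroup H] [InnerProductSpace ℝ H] [CompleteSpace H]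
    [RKHS ℝ H X ℝ] (hK : KernelL2.HasKernel H K) (h : KernelL2.DenseContractiveInclusion μ H) :
    -- `A = (J J*)⁻¹` has exactly one positive self-adjoint square root `S = A^{1/2}`,
    (∃! S : Lp ℝ 2 μ →ₗ.[ℝ] Lp ℝ 2 μ, KernelL2.IsPositiveSqrt S h.opA) ∧
    -- and `x ↦ A^{1/2} K_x` is well defined and a feature map for `K` into `L²(μ)`.
    (∀ S : Lp ℝ 2 μ →ₗ.[ℝ] Lp ℝ 2 μ, KernelL2.IsPositiveSqrt S h.opA →
      ∃ hdom : ∀ x : X, h.incl (KernelL2.kerSection H x) ∈ S.domain,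
        KernelL2.IsFeatureMap K (fun x : X => S ⟨h.incl (KernelL2.kerSection H x), hdom x⟩)) ∧
    -- If `A⁻¹` is compact, with an orthonormal basis of eigenvectors, then the kernel expands.
    (∀ (ι : Type*) (u : HilbertBasis ι ℝ (Lp ℝ 2 μ)) (lam : ι → ℝ),
      IsCompactOperator h.opAInv →
      (∀ i : ι, h.opAInv (u i) = lam i • u i) →
        (∀ i : ι, 0 < lam i ∧ lam i ≤ 1) ∧
        ∀ x y : X,
          HasSum (fun i : ι => (lam i)⁻¹ * ⟪h.incl (KernelL2.kerSection H x), u i⟫_ℝ *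
            ⟪u i, h.incl (KernelL2.kerSection H y)⟫_ℝ) (K x y)) := by
  obtain ⟨B, hB, hinj, hBB, hcomm⟩ := h.exists_sqrt_opAInv
  obtain ⟨V, hBV, hV⟩ :=
    exists_comp_eq_of_mul_self_eq h.denseRange_adjoint_incl hB.isSelfAdjoint hBB
  have hgraph (S : Lp ℝ 2 μ →ₗ.[ℝ] Lp ℝ 2 μ) (hS : KernelL2.IsPositiveSqrt S h.opA) :=
    hS.mem_graph_iff h.mem_graph_opA_iff hB hBB hcomm
  refine ⟨?_, fun S hS => ?_, fun ι u lam _ hu => ?_⟩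
  · have hS (v w : Lp ℝ 2 μ) :=
      LinearPMap.mem_graph_inverse_toPMap_top_iff hinj (v := v) (w := w)
    refine ⟨_, KernelL2.isPositiveSqrt_of_mem_graph_iff h.mem_graph_opA_iff hB hinj hBB hS,
      fun S' hS' => LinearPMap.eq_of_eq_graph ?_⟩
    ext ⟨v, w⟩
    rw [hgraph S' hS', hS]
  · have hmem (f : H) : (h.incl f, V f) ∈ S.graph := (hgraph S hS _ _).2 (hBV f)
    have hdom (f : H) : h.incl f ∈ S.domain := LinearPMap.mem_domain_of_mem_graph (hmem f)
    have happ (f : H) : S ⟨h.incl f, hdom f⟩ = V f :=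
      ((LinearPMap.image_iff (hdom f)).2 (hmem f)).symm
    refine ⟨fun x => hdom _, fun x y => ?_⟩
    simp only [happ, hV, hK.inner_kerSection]
  · have hlam (i : ι) := h.eigenvalue_opAInv_pos_and_le_one (u.orthonormal.1 i) (hu i)
    refine ⟨hlam, fun x y => ?_⟩
    have hcoef (f : H) (i : ι) : ⟪h.incl f, u i⟫_ℝ = √(lam i) * ⟪V f, u i⟫_ℝ := by
      have hBu : B (u i) = √(lam i) • u i :=
        hB.apply_eq_sqrt_smul (hlam i).1 (by rw [hBB, hu])
      rw [← hBV, hB.inner_left_eq_inner_right, hBu, real_inner_smul_right]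
    have hsum := u.hasSum_inner_mul_inner (V (KernelL2.kerSection H x))
      (V (KernelL2.kerSection H y))
    rw [hV, hK.inner_kerSection] at hsum
    refine hsum.congr_fun fun i => ?_
    have hsqrt : √(lam i) * √(lam i) = lam i := Real.mul_self_sqrt (hlam i).1.le
    have hne : lam i ≠ 0 := (hlam i).1.ne'
    rw [real_inner_comm _ (u i), real_inner_comm _ (u i), hcoef, hcoef]
    field_simp
    linear_combination ⟪V (KernelL2.kerSection H x), u i⟫_ℝ *
      ⟪V (KernelL2.kerSection H y), u i⟫_ℝ * hsqrt
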